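/- Let $S$ be a finite or countable set and let $X=\{(X_t)_{t\ge 0},(\mathbb{P}_i)_{i\in S}\}$ be a continuous time Markov chain with state space $S$ and almost surely right-continuous paths (for the discrete topology on $S$), where $\mathbb{P}_i(X_0=i)=1$, with transition probabilities $p_{ij}(t)=\mathbb{P}_i(X_t=j)$ and $q$-matrix $Q=(q_{ij})_{i,j\in S}$, $q_{ij}=p_{ij}'(0)\in\mathbb{R}$. Assume that $Q$ is conservative, that is, $\sum_{j\in S}q_{ij}=0$ for all $i\in S$, and that $X$ is not explosive, that is, almost surely it has only finitely many jumps in every bounded time interval. Let $D\subset S$, $E=S\setminus D$, and let $T=\inf\{t\ge 0: X_t\in D\}$ (with $\inf\emptyset=\infty$) be the first passage time in $D$. For $i\in E$ define the killing rate $\eta_i=\sum_{j\in D}q_{ij}$, and let $\alpha_0=\inf_{i\in E}\eta_i\in[0,\infty)$ and $\alpha_1=\sup_{i\in E}\eta_i\in[0,\infty]$. Then $$e^{-\alpha_1 t}\le \mathbb{P}_i(t<T)\le e^{-\alpha_0 t}\qquad\text{for all } t\ge 0 \text{ and all } i\in E,$$ where, if $\alpha_1=\infty$, $e^{-\alpha_1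 t}$ is read as $0$ for $t>0$ and as $1$ for $t=0$. -/

import Mathlib

open MeasureTheory Set Filter Topology
open scoped NNReal ENNReal

/-- Transition probabilities `p_{ij}(t) = ℙ_i(X_t = j)` of a process `X` under the family of laws
`P i = ℙ_i`. -/
noncomputable def transitionProb {S Ω : Type*} [MeasurableSpace Ω]
    (X : ℝ≥0 → Ω → S) (P : S → Measure Ω) (t : ℝ≥0) (i j : S) : ℝ :=
  (P i).real {ω | X t ω = j}

/-- `X` under the laws `(P i)`, `i ∈ S`, is a (time homogeneous) continuous time Markov chain on the
state space `S`: under `P i` it starts from `i`, its paths are almost surely right-continuous for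
the discrete topology of `S`, and it has the Markov property with respect to its own filtration
`σ(X_u, u ≤ s)`, with transition probabilities `ℙ_j(X_t = k)`. -/
structure IsContinuousTimeMarkovChain {S Ω : Type*} [MeasurableSpace S] [MeasurableSpace Ω]
    (X : ℝ≥0 → Ω → S) (P : S → Measure Ω) : Prop where
  measurable : ∀ t, Measurable (X t)
  isProbabilityMeasure : ∀ i, IsProbabilityMeasure (P i)
  start : ∀ i, ∀ᵐ ω ∂(P i), X 0 ω = i
  rightContinuous : ∀ i, ∀ᵐ ω ∂(P i), ∀ t, ∀ᶠ u in 𝓝[≥] t, X u ω = X t ω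
  markov : ∀ (i : S) (s t : ℝ≥0) (A : Set Ω),
    MeasurableSet[⨆ u ≤ s, MeasurableSpace.comap (X u) inferInstance] A → ∀ j k : S,
      P i (A ∩ {ω | X s ω = j} ∩ {ω | X (s + t) ω = k})
        = P i (A ∩ {ω | X s ω = j}) * P j {ω | X t ω = k}

/-- The set of jump times of a path: the times at which it is not locally constant. -/
def jumpTimes {S : Type*} (x : ℝ≥0 → S) : Set ℝ≥0 :=
  {t | ¬ ∀ᶠ u in 𝓝 t, x u = x t}

/-- Non-explosion: almost surely there are only finitely many jumps in every bounded time
interval. -/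
def IsNonExplosive {S Ω : Type*} [MeasurableSpace Ω]
    (X : ℝ≥0 → Ω → S) (P : S → Measure Ω) : Prop :=
  ∀ i, ∀ᵐ ω ∂(P i), ∀ t : ℝ≥0, (jumpTimes (fun u ↦ X u ω) ∩ Iic t).Finite

/-- `q` is the `q`-matrix of the chain: `q_{ij} = p_{ij}'(0)` (derivative from the right). -/
def IsQMatrix {S Ω : Type*} [MeasurableSpace Ω]
    (X : ℝ≥0 → Ω → S) (P : S → Measure Ω) (q : S → S → ℝ) : Prop :=
  ∀ i j, HasDerivWithinAt (fun t : ℝ ↦ transitionProb X P t.toNNReal i j) (q i j) (Ici 0) 0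

/-- A `q`-matrix is conservative if each of its rows sums to `0`. -/
def IsConservative {S : Type*} (q : S → S → ℝ) : Prop :=
  ∀ i, HasSum (fun j ↦ q i j) 0

/-- The first passage time `T = inf {t ≥ 0 : X_t ∈ D}` (`⊤` if `D` is never visited). -/
noncomputable def firstPassageTime {S Ω : Type*} (X : ℝ≥0 → Ω → S) (D : Set S) :
    Ω → WithTop ℝ≥0 :=
  hittingAfter X D 0

/-- The killing rate `η_i = ∑_{j ∈ D} q_{ij}`. -/
noncomputable def killingRate {S : Type*} (q : S → S → ℝ) (D : Set S) (i : S) : ℝ :=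
  ∑' j : D, q i j

/-- `α₀ = inf_{i ∈ E} η_i`, with `E = S \ D`. -/
noncomputable def infKillingRate {S : Type*} (q : S → S → ℝ) (D : Set S) : EReal :=
  ⨅ i ∈ Dᶜ, (killingRate q D i : EReal)

/-- `α₁ = sup_{i ∈ E} η_i`, with `E = S \ D`; it may be `+∞`. -/
noncomputable def supKillingRate {S : Type*} (q : S → S → ℝ) (D : Set S) : EReal :=
  ⨆ i ∈ Dᶜ, (killingRate q D i : EReal)

/-! ### Regular grids and exponential rates. -/

section Grid

/-! Observe the chain on the grid of mesh `h = t / n`. Since the chain is conservative, `ℙ_j(X_h ∉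
D) = 1 - η_j h + o(h)`, which lies below (above) `e^{-ch}` for small `h` when `c < η_j` (`c > η_j`).
Multiplying `n` such factors by the Markov property gives `e^{-ct}`.

The `o(h)` is not uniform in `j`. Non-explosion repairs this: a path has finite range on `[0, t]`,
so outside an event of probability below `δ` it stays in a finite set `F`
(`exists_finite_measure_exit_lt`), and on `F` one mesh serves all states. The iterations are
`measure_grid_le_pow` and `pow_le_measure_grid_add`. Right-continuity identifies `{t < T}` almost
surely with avoidance of `D` on all grids; finally `δ → 0` and `c` tends to `α₀` or `α₁`. -/

lemma grid_point_le (t : ℝ≥0) {n k : ℕ} (hk : k ≤ n) : (k : ℝ≥0) * (t / n) ≤ t := by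
  rcases n.eq_zero_or_pos with rfl | hn
  · simp
  · have : (0 : ℝ≥0) < n := by exact_mod_cast hn
    calc (k : ℝ≥0) * (t / n) ≤ n * (t / n) := by gcongr
      _ = t := mul_div_cancel₀ _ this.ne'

lemma tendsto_div_nat_nhdsGT {t : ℝ≥0} (ht : 0 < t) :
    Tendsto (fun n : ℕ ↦ (t : ℝ) / n) atTop (𝓝[>] 0) := by
  refine tendsto_nhdsWithin_iff.2 ⟨tendsto_const_div_atTop_nhds_zero_nat _, ?_⟩
  filter_upwards [eventually_ge_atTop 1] with n hn
  have : (0 : ℝ) < n := by exact_mod_cast hn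
  exact div_pos (NNReal.coe_pos.2 ht) this

lemma ofReal_exp_pow {c t : ℝ} {n : ℕ} (hn : 1 ≤ n) :
    ENNReal.ofReal (Real.exp (-(c * (t / n)))) ^ n = ENNReal.ofReal (Real.exp (-(c * t))) := by
  rw [← ENNReal.ofReal_pow (Real.exp_pos _).le, ← Real.exp_nat_mul]
  congr 2
  have : (n : ℝ) ≠ 0 := by positivity
  field_simp

lemma tendsto_ofReal_exp_neg_mul (a t : ℝ) :
    Tendsto (fun c : ℝ ↦ ENNReal.ofReal (Real.exp (-(c * t)))) (𝓝 a)
      (𝓝 (ENNReal.ofReal (Real.exp (-(a * t))))) :=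
  (ENNReal.continuous_ofReal.comp (by fun_prop)).tendsto a

end Grid

/-! ### Right-continuous paths with finitely many jumps. -/

section Paths

variable {S : Type*}

/-- A right-continuous path with finitely many jumps before `t` visits finitely many states. -/
lemma finite_image_Iic_of_finite_jumpTimes {x : ℝ≥0 → S}
    (hrc : ∀ t, ∀ᶠ u in 𝓝[≥] t, x u = x t) (t : ℝ≥0) (hfin : (jumpTimes x ∩ Iic t).Finite) :
    (x '' Iic t).Finite := by
  have hIcc : Iic t = Icc 0 t := by ext; simp
  have hc : IsCompact (Iic t) := by rw [hIcc]; exact isCompact_Icc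
  refine hc.induction_on (p := fun s ↦ (x '' s).Finite) (by simp)
    (fun s u hsu hu ↦ hu.subset (image_mono hsu))
    (fun s u hs hu ↦ by rw [image_union]; exact hs.union hu) ?_
  intro s hs
  suffices h : ∃ u ∈ 𝓝 s, (x '' u).Finite by
    obtain ⟨u, hu, hu'⟩ := h
    exact ⟨u, mem_nhdsWithin_of_mem_nhds hu, hu'⟩
  have hright : ∃ u ∈ 𝓝[≥] s, (x '' u).Finite := by
    refine ⟨_, hrc s, (finite_singleton (x s)).subset ?_⟩
    rintro _ ⟨u, hu, rfl⟩
    exact hu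
  have hleft : ∃ u ∈ 𝓝[<] s, (x '' u).Finite := by
    rcases eq_or_ne s 0 with rfl | h0
    · exact ⟨∅, by simp, by simp⟩
    have h1 : ∀ᶠ u in 𝓝[<] s, u ∉ jumpTimes x ∩ Iic t := by
      have : ((jumpTimes x ∩ Iic t) \ {s})ᶜ ∈ 𝓝 s :=
        (hfin.subset sdiff_subset).isClosed.isOpen_compl.mem_nhds (by simp)
      filter_upwards [mem_nhdsWithin_of_mem_nhds this, self_mem_nhdsWithin] with u hu hus hj
      exact hu ⟨hj, ne_of_lt hus⟩
    obtain ⟨b, hb, hbs⟩ := (mem_nhdsLT_iff_exists_Ioo_subset' (pos_iff_ne_zero.2 h0)).1 h1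
    refine ⟨Ioo b s, Ioo_mem_nhdsLT hb, Set.Subsingleton.finite ?_⟩
    -- Between consecutive jump times the path is continuous into a discrete space, so connectedness
    -- makes it constant.
    let _ : TopologicalSpace S := ⊥
    have : DiscreteTopology S := ⟨rfl⟩
    have hcont : ContinuousOn x (Ioo b s) := by
      intro u hu
      have : u ∉ jumpTimes x := fun hj ↦ hbs hu ⟨hj, hu.2.le.trans hs⟩
      rw [jumpTimes, mem_ofPred_eq, not_not] at this
      refine ContinuousAt.continuousWithinAt ?_
      rw [ContinuousAt, nhds_discrete S, tendsto_pure]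
      exact this
    exact (isPreconnected_Ioo.image x hcont).subsingleton
  obtain ⟨u, hu, hu'⟩ := hright
  obtain ⟨v, hv, hv'⟩ := hleft
  refine ⟨v ∪ u, ?_, by rw [image_union]; exact hv'.union hu'⟩
  rw [← nhdsLT_sup_nhdsGE]
  exact ⟨mem_of_superset hv subset_union_left, mem_of_superset hu subset_union_right⟩

/-- A right-continuous path that visits `D` before `t` is seen in `D` on all fine regular grids
of `[0, t]`. -/
lemma eventually_exists_grid_mem {x : ℝ≥0 → S} (hrc : ∀ t, ∀ᶠ u in 𝓝[≥] t, x u = x t)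
    {D : Set S} {s t : ℝ≥0} (hst : s ≤ t) (hs : x s ∈ D) :
    ∀ᶠ n : ℕ in atTop, ∃ k ≤ n, x (k * (t / n)) ∈ D := by
  rcases hst.eq_or_lt with rfl | hlt
  · filter_upwards [eventually_ge_atTop 1] with n hn
    refine ⟨n, le_rfl, ?_⟩
    rwa [mul_div_cancel₀]
    positivity
  -- The path keeps its value on `[s, d)`; once the mesh is below `d - s`, the first grid point at
  -- or after `s` falls there.
  · obtain ⟨d, ⟨hd, hdt⟩, hsub⟩ :=
      (mem_nhdsGE_iff_exists_mem_Ioc_Ico_subset hlt).1 (hrc s)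
    have hlim : Tendsto (fun n : ℕ ↦ t / n) atTop (𝓝 0) :=
      tendsto_const_div_atTop_nhds_zero_nat t
    filter_upwards [hlim.eventually_lt_const (tsub_pos_of_lt hd), eventually_ge_atTop 1]
      with n hn hn1
    have ht : 0 < t := pos_of_gt hlt
    have hn0 : (0 : ℝ≥0) < n := by exact_mod_cast hn1
    have hh : 0 < t / n := by positivity
    have h1 : s ≤ ⌈s / (t / n)⌉₊ * (t / n) := (div_le_iff₀ hh).1 (Nat.le_ceil _)
    have h2 : ⌈s / (t / n)⌉₊ * (t / n) < d := by
      calc (⌈s / (t / n)⌉₊ : ℝ≥0) * (t / n) < (s / (t / n) + 1) * (t / n) := by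
            gcongr
            exact Nat.ceil_lt_add_one zero_le
        _ = s + t / n := by rw [add_mul, div_mul_cancel₀ _ hh.ne', one_mul]
        _ < d := lt_tsub_iff_left.1 hn
    refine ⟨⌈s / (t / n)⌉₊, ?_, ?_⟩
    · rw [Nat.ceil_le, div_le_iff₀ hh, mul_div_cancel₀ _ hn0.ne']
      exact hst
    · have := hsub ⟨h1, h2⟩
      rw [mem_ofPred_eq] at this
      rwa [this]

/-- For a right-continuous path, the first passage time in `D` exceeds `t` if and only if the path
avoids `D` on all regular grids of `[0, t]`. -/
lemma lt_firstPassageTime_iff {Ω : Type*} {X : ℝ≥0 → Ω → S} {D : Set S} {ω : Ω}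
    (hrc : ∀ t, ∀ᶠ u in 𝓝[≥] t, X u ω = X t ω) (t : ℝ≥0) :
    (t : WithTop ℝ≥0) < firstPassageTime X D ω ↔
      ∀ n k : ℕ, k ≤ n → X (k * (t / n)) ω ∉ D := by
  constructor
  · intro h n k hk
    refine notMem_of_lt_hittingAfter (lt_of_le_of_lt ?_ h) zero_le
    norm_cast
    exact grid_point_le t hk
  · intro h
    have hnot : ∀ s ≤ t, X s ω ∉ D := by
      intro s hs hsD
      obtain ⟨n, k, hk, hkD⟩ := (eventually_exists_grid_mem (x := fun u ↦ X u ω) hrc hs hsD).exists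
      exact h n k hk hkD
    -- Avoiding `D` on `[0, t]` only gives `t ≤ T`; right-continuity at `t` extends this to `[0, d)`
    -- and makes it strict.
    obtain ⟨d, hd, hsub⟩ := (mem_nhdsGE_iff_exists_Ico_subset).1 (hrc t)
    have hd' : (t : WithTop ℝ≥0) < (d : WithTop ℝ≥0) := by exact_mod_cast hd
    refine hd'.trans_le ?_
    rw [firstPassageTime, hittingAfter]
    split_ifs with hex
    · norm_cast
      refine le_csInf hex ?_
      rintro u ⟨-, hu⟩
      by_contra! hlt
      rcases le_or_gt u t with hut | hut
      · exact hnot u hut hu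
      · have := hsub ⟨hut.le, hlt⟩
        rw [mem_ofPred_eq] at this
        rw [this] at hu
        exact hnot t le_rfl hu
    · exact le_top

end Paths

lemma IsConservative.tsum_compl {S : Type*} {q : S → S → ℝ} (hcons : IsConservative q)
    (D : Set S) (i : S) :
    ∑' j : (Dᶜ : Set S), q i j = -killingRate q D i := by
  have h := (hcons i).summable.tsum_subtype_add_tsum_subtype_compl D
  rw [(hcons i).tsum_eq] at h
  rw [killingRate]
  linarith

lemma measurableSet_grid {S Ω : Type*} [Countable S] [MeasurableSpace S]
    [MeasurableSingletonClass S] (X : ℝ≥0 → Ω → S) (C : Set S) (h : ℝ≥0) (k : ℕ) :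
    MeasurableSet[⨆ u ≤ (k * h : ℝ≥0), MeasurableSpace.comap (X u) inferInstance]
      {ω | ∀ m ≤ k, X (m * h) ω ∈ C} := by
  simp only [ofPred_forall]
  refine MeasurableSet.iInter fun m ↦ MeasurableSet.iInter fun hm ↦ ?_
  have hle : (m : ℝ≥0) * h ≤ k * h := by gcongr
  refine le_iSup₂_of_le (f := fun u (_ : u ≤ (k * h : ℝ≥0)) ↦
    MeasurableSpace.comap (X u) inferInstance) _ hle le_rfl _ ?_
  exact ⟨C, C.to_countable.measurableSet, rfl⟩

/-! ### One-step estimates from the `q`-matrix. -/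

section Basic

variable {S Ω : Type*} [MeasurableSpace S] [MeasurableSpace Ω] {X : ℝ≥0 → Ω → S}
  {P : S → Measure Ω}

lemma IsContinuousTimeMarkovChain.iSup_comap_le (hX : IsContinuousTimeMarkovChain X P) (s : ℝ≥0) :
    (⨆ u ≤ s, MeasurableSpace.comap (X u) inferInstance) ≤ (inferInstance : MeasurableSpace Ω) :=
  iSup₂_le fun u _ ↦ (hX.measurable u).comap_le

lemma lt_firstPassageTime_ae_eq (hX : IsContinuousTimeMarkovChain X P) (D : Set S) (t : ℝ≥0)
    (i : S) : {ω | (t : WithTop ℝ≥0) < firstPassageTime X D ω} =ᵐ[P i]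
      {ω | ∀ n k : ℕ, k ≤ n → X (k * (t / n)) ω ∉ D} := by
  filter_upwards [hX.rightContinuous i] with ω hrc
  exact propext (lt_firstPassageTime_iff hrc t)

lemma measure_zero_lt_firstPassageTime (hX : IsContinuousTimeMarkovChain X P) {D : Set S} {i : S}
    (hi : i ∉ D) : P i {ω | ((0 : ℝ≥0) : WithTop ℝ≥0) < firstPassageTime X D ω} = 1 := by
  have := hX.isProbabilityMeasure i
  rw [measure_congr (lt_firstPassageTime_ae_eq hX D 0 i), ← measure_univ (μ := P i)]
  refine measure_congr (eventuallyEq_univ.2 ?_)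
  filter_upwards [hX.start i] with ω hω
  intro n k _
  simpa [hω] using hi

lemma IsQMatrix.nonneg {q : S → S → ℝ} (hX : IsContinuousTimeMarkovChain X P)
    (hq : IsQMatrix X P q) {i j : S} (hij : i ≠ j) : 0 ≤ q i j := by
  have h := hq i j
  rw [hasDerivWithinAt_iff_tendsto_slope, Ici_sdiff_left] at h
  refine ge_of_tendsto h ?_
  filter_upwards [self_mem_nhdsWithin] with u hu
  have h0 : transitionProb X P (0 : ℝ).toNNReal i j = 0 := by
    have : {ω | X 0 ω = j} =ᵐ[P i] (∅ : Set Ω) := by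
      rw [eventuallyEq_empty]
      filter_upwards [hX.start i] with ω hω
      exact fun h ↦ hij (hω.symm.trans h)
    rw [transitionProb, Real.toNNReal_zero, measureReal_congr this]
    simp
  rw [slope_def_field, h0, sub_zero, sub_zero]
  exact div_nonneg measureReal_nonneg (le_of_lt hu)

lemma IsQMatrix.killingRate_nonneg {q : S → S → ℝ} (hX : IsContinuousTimeMarkovChain X P)
    (hq : IsQMatrix X P q) {D : Set S} {i : S} (hi : i ∉ D) : 0 ≤ killingRate q D i :=
  tsum_nonneg fun j ↦ hq.nonneg hX fun h ↦ hi (h ▸ j.2)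

/-- If `∑_{j ∈ C} q_{ij} > c` then `ℙ_i(X_h ∈ C) > 1_C(i) + c h` for all small `h`. -/
lemma IsQMatrix.eventually_lt_measure_mem [MeasurableSingletonClass S]
    (hX : IsContinuousTimeMarkovChain X P)
    {q : S → S → ℝ} (hq : IsQMatrix X P q) (hcons : IsConservative q) (i : S) (C : Set S)
    {c : ℝ} (hc : c < ∑' j : C, q i j) :
    ∀ᶠ h : ℝ in 𝓝[>] 0,
      C.indicator 1 i + c * h < (P i).real {ω | X h.toNNReal ω ∈ C} := by
  classical
  have := hX.isProbabilityMeasure i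
  have hsum : HasSum (fun j : C ↦ q i j) (∑' j : C, q i j) :=
    ((hcons i).summable.subtype C).hasSum
  -- Only a lower bound is needed, so a finite partial sum, differentiable term by term, suffices.
  -- It must include `i` when `i ∈ C` to have the right value at time `0`.
  have hev : ∀ᶠ s : Finset C in atTop, c < ∑ j ∈ s, q i j := hsum.eventually_const_lt hc
  obtain ⟨s, hs, hsi⟩ := (hev.and (eventually_ge_atTop
    (if hi : i ∈ C then {⟨i, hi⟩} else ∅ : Finset C))).exists
  have hder : HasDerivWithinAt
      (fun t : ℝ ↦ ∑ j ∈ s, transitionProb X P t.toNNReal i j) (∑ j ∈ s, q i j) (Ici 0) 0 :=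
    HasDerivWithinAt.fun_sum fun j _ ↦ hq i j
  have h0 : ∑ j ∈ s, transitionProb X P (0 : ℝ).toNNReal i j = C.indicator 1 i := by
    have hp : ∀ j, transitionProb X P (0 : ℝ).toNNReal i j = if i = j then 1 else 0 := by
      intro j
      rw [transitionProb, Real.toNNReal_zero]
      split_ifs with hij
      · have : {ω | X 0 ω = j} =ᵐ[P i] univ := by
          rw [eventuallyEq_univ]
          filter_upwards [hX.start i] with ω hω
          exact hω.trans hij
        rw [measureReal_congr this]
        simp
      · have : {ω | X 0 ω = j} =ᵐ[P i] (∅ : Set Ω) := by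
          rw [eventuallyEq_empty]
          filter_upwards [hX.start i] with ω hω
          exact fun h ↦ hij (hω.symm.trans h)
        rw [measureReal_congr this]
        simp
    simp_rw [hp]
    by_cases hi : i ∈ C
    · rw [dif_pos hi] at hsi
      have hmem : (⟨i, hi⟩ : C) ∈ s := hsi (Finset.mem_singleton_self _)
      rw [Finset.sum_eq_single_of_mem _ hmem]
      · simp [hi]
      · intro j _ hj
        rw [if_neg]
        rintro h
        exact hj (Subtype.ext h.symm)
    · rw [Finset.sum_eq_zero]
      · simp [hi]
      · intro j _
        rw [if_neg]
        rintro rfl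
        exact hi j.2
  rw [hasDerivWithinAt_iff_tendsto_slope, Ici_sdiff_left] at hder
  filter_upwards [hder.eventually_const_lt hs, self_mem_nhdsWithin] with h hh hpos
  rw [slope_def_field, sub_zero, lt_div_iff₀ hpos, h0] at hh
  refine (lt_sub_iff_add_lt'.1 hh).trans_le ?_
  simp_rw [transitionProb]
  have hun : ∑ j ∈ s, (P i).real {ω | X h.toNNReal ω = j}
      = (P i).real (⋃ j ∈ s, {ω | X h.toNNReal ω = (j : S)}) := by
    rw [measureReal_biUnion_finset]
    · intro a _ b _ hab
      rw [Function.onFun, Set.disjoint_left]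
      intro ω ha hb
      rw [mem_ofPred_eq] at ha hb
      exact hab (Subtype.ext (ha.symm.trans hb))
    · exact fun j _ ↦ hX.measurable _ (measurableSet_singleton _)
  rw [hun]
  refine measureReal_mono ?_
  intro ω hω
  simp only [mem_iUnion, mem_ofPred_eq] at hω
  obtain ⟨j, -, hj⟩ := hω
  rw [mem_ofPred_eq, hj]
  exact j.2

lemma IsQMatrix.eventually_le_measure_compl [MeasurableSingletonClass S]
    (hX : IsContinuousTimeMarkovChain X P)
    {q : S → S → ℝ} (hq : IsQMatrix X P q) (hcons : IsConservative q) {D : Set S} {i : S}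
    (hi : i ∉ D) {c : ℝ} (hc : killingRate q D i < c) :
    ∀ᶠ h : ℝ in 𝓝[>] 0,
      ENNReal.ofReal (Real.exp (-(c * h))) ≤ P i {ω | X h.toNNReal ω ∈ Dᶜ} := by
  have := hX.isProbabilityMeasure i
  -- The intermediate rate separates the two expansions: `e^{-ch} < 1 - dh < ℙ_i(X_h ∉ D)`.
  obtain ⟨d, hd, hdc⟩ := exists_between hc
  have hlt : -d < ∑' j : (Dᶜ : Set S), q i j := by
    rw [hcons.tsum_compl]
    linarith
  have hexp : ∀ᶠ h : ℝ in 𝓝[>] 0, Real.exp (-(c * h)) < 1 - d * h := by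
    have hder : HasDerivAt (fun h : ℝ ↦ Real.exp (-(c * h))) (-c) 0 := by
      have := (((hasDerivAt_id (0 : ℝ)).const_mul c).neg).exp
      simpa using this
    have h' := hder.hasDerivWithinAt (s := Ici 0)
    rw [hasDerivWithinAt_iff_tendsto_slope, Ici_sdiff_left] at h'
    filter_upwards [h'.eventually_lt_const (neg_lt_neg hdc), self_mem_nhdsWithin] with h hh hpos
    rw [slope_def_field, sub_zero, div_lt_iff₀ hpos] at hh
    simp only [mul_zero, neg_zero, Real.exp_zero] at hh
    linarith
  filter_upwards [hq.eventually_lt_measure_mem hX hcons i Dᶜ hlt, hexp] with h hh he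
  rw [indicator_of_mem (by exact hi), Pi.one_apply] at hh
  rw [← ofReal_measureReal]
  refine ENNReal.ofReal_le_ofReal ?_
  linarith

end Basic

/-! ### Iteration along the grid and passage to the limit. -/

section Chain

variable {S Ω : Type*} [Countable S] [MeasurableSpace S] [MeasurableSingletonClass S]
  [MeasurableSpace Ω] {X : ℝ≥0 → Ω → S} {P : S → Measure Ω}

lemma tsum_measure_inter_eq {μ : Measure Ω} {Y : Ω → S} (hY : Measurable Y) (A : Set Ω)
    (C : Set S) : ∑' j : C, μ (A ∩ {ω | Y ω = j}) = μ (A ∩ {ω | Y ω ∈ C}) := by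
  have h := tsum_measure_preimage_singleton (μ := μ.restrict A) C.to_countable (f := Y)
    fun y _ ↦ hY (measurableSet_singleton y)
  rw [Measure.restrict_apply (hY C.to_countable.measurableSet)] at h
  simp_rw [Measure.restrict_apply (hY (measurableSet_singleton _))] at h
  simp_rw [inter_comm A]
  exact h

lemma measure_eq_tsum_of_forall_mem {μ : Measure Ω} {Y : Ω → S} (hY : Measurable Y) {A : Set Ω}
    {B : Set S} (hAB : ∀ ω ∈ A, Y ω ∈ B) : μ A = ∑' j : B, μ (A ∩ {ω | Y ω = j}) := by
  rw [tsum_measure_inter_eq hY, inter_eq_left.2 (show A ⊆ {ω | Y ω ∈ B} from hAB)]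

namespace IsContinuousTimeMarkovChain

variable (hX : IsContinuousTimeMarkovChain X P)
include hX

lemma measurableSet_mem (t : ℝ≥0) (C : Set S) : MeasurableSet {ω | X t ω ∈ C} :=
  hX.measurable t C.to_countable.measurableSet

lemma markov_mem (i : S) (s t : ℝ≥0) {A : Set Ω}
    (hA : MeasurableSet[⨆ u ≤ s, MeasurableSpace.comap (X u) inferInstance] A) (j : S)
    (C : Set S) : P i (A ∩ {ω | X s ω = j} ∩ {ω | X (s + t) ω ∈ C})
      = P i (A ∩ {ω | X s ω = j}) * P j {ω | X t ω ∈ C} := by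
  rw [← tsum_measure_inter_eq (hX.measurable (s + t))]
  simp_rw [hX.markov i s t A hA]
  rw [ENNReal.tsum_mul_left]
  congr 1
  have := tsum_measure_inter_eq (μ := P j) (hX.measurable t) univ C
  simpa only [univ_inter] using this

lemma measure_inter_le_mul (i : S) (s t : ℝ≥0) {A : Set Ω}
    (hA : MeasurableSet[⨆ u ≤ s, MeasurableSpace.comap (X u) inferInstance] A) {B C : Set S}
    (hAB : ∀ ω ∈ A, X s ω ∈ B) {c : ℝ≥0∞} (hc : ∀ j ∈ B, P j {ω | X t ω ∈ C} ≤ c) :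
    P i (A ∩ {ω | X (s + t) ω ∈ C}) ≤ c * P i A := by
  have hcomm : ∀ j : S, A ∩ {ω | X s ω = j} ∩ {ω | X (s + t) ω ∈ C} =
      A ∩ {ω | X (s + t) ω ∈ C} ∩ {ω | X s ω = j} := fun j ↦ inter_right_comm _ _ _
  rw [measure_eq_tsum_of_forall_mem (hX.measurable s) hAB,
    measure_eq_tsum_of_forall_mem (A := A ∩ {ω | X (s + t) ω ∈ C}) (hX.measurable s)
      fun ω hω ↦ hAB ω hω.1, ← ENNReal.tsum_mul_left]
  refine ENNReal.tsum_le_tsum fun j ↦ ?_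
  rw [← hcomm, hX.markov_mem i s t hA, mul_comm]
  gcongr
  exact hc j j.2

lemma mul_le_measure_inter (i : S) (s t : ℝ≥0) {A : Set Ω}
    (hA : MeasurableSet[⨆ u ≤ s, MeasurableSpace.comap (X u) inferInstance] A) {B C : Set S}
    (hAB : ∀ ω ∈ A, X s ω ∈ B) {c : ℝ≥0∞} (hc : ∀ j ∈ B, c ≤ P j {ω | X t ω ∈ C}) :
    c * P i A ≤ P i (A ∩ {ω | X (s + t) ω ∈ C}) := by
  have hcomm : ∀ j : S, A ∩ {ω | X s ω = j} ∩ {ω | X (s + t) ω ∈ C} =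
      A ∩ {ω | X (s + t) ω ∈ C} ∩ {ω | X s ω = j} := fun j ↦ inter_right_comm _ _ _
  rw [measure_eq_tsum_of_forall_mem (hX.measurable s) hAB,
    measure_eq_tsum_of_forall_mem (A := A ∩ {ω | X (s + t) ω ∈ C}) (hX.measurable s)
      fun ω hω ↦ hAB ω hω.1, ← ENNReal.tsum_mul_left]
  refine ENNReal.tsum_le_tsum fun j ↦ ?_
  rw [← hcomm, hX.markov_mem i s t hA, mul_comm]
  gcongr
  exact hc j j.2

lemma measure_grid_le_pow (i : S) (h : ℝ≥0) {B C : Set S} (hBC : B ⊆ C) {c : ℝ≥0∞}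
    (hc : ∀ j ∈ B, P j {ω | X h ω ∈ C} ≤ c) (k : ℕ) :
    P i {ω | ∀ m ≤ k, X (m * h) ω ∈ B} ≤ c ^ k := by
  induction k with
  | zero =>
    have := hX.isProbabilityMeasure i
    simpa using prob_le_one
  | succ k ih =>
    calc P i {ω | ∀ m ≤ k + 1, X (m * h) ω ∈ B}
        ≤ P i ({ω | ∀ m ≤ k, X (m * h) ω ∈ B} ∩ {ω | X (k * h + h) ω ∈ C}) := by
          refine measure_mono fun ω hω ↦ ⟨fun m hm ↦ hω m (by omega), hBC ?_⟩
          simpa [add_mul] using hω (k + 1) le_rfl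
      _ ≤ c * P i {ω | ∀ m ≤ k, X (m * h) ω ∈ B} :=
          hX.measure_inter_le_mul i _ h (measurableSet_grid X B h k)
            (fun ω hω ↦ hω k le_rfl) hc
      _ ≤ c * c ^ k := by gcongr
      _ = c ^ (k + 1) := (pow_succ' c k).symm

/-- The one-step bound fails outside `F`, but a path is lost only at its first exit from `F`. These
exits are disjoint events, so the total loss is one exit probability, whatever `k` is. -/
lemma pow_le_measure_grid_add (i : S) (h : ℝ≥0) {C F : Set S} (hiC : i ∈ C) (hiF : i ∈ F)
    {c : ℝ≥0∞} (hc1 : c ≤ 1) (hc : ∀ j ∈ C ∩ F, c ≤ P j {ω | X h ω ∈ C}) (k : ℕ) :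
    c ^ k ≤ P i {ω | ∀ m ≤ k, X (m * h) ω ∈ C ∩ F} + P i {ω | ∃ m ≤ k, X (m * h) ω ∉ F} := by
  induction k with
  | zero =>
    have h0 : P i {ω | ∀ m ≤ 0, X ((m : ℕ) * h) ω ∈ C ∩ F} = 1 := by
      have := hX.isProbabilityMeasure i
      have hae : ∀ᵐ ω ∂(P i), ω ∈ {ω | ∀ m ≤ 0, X ((m : ℕ) * h) ω ∈ C ∩ F} := by
        filter_upwards [hX.start i] with ω hω
        intro m hm
        obtain rfl : m = 0 := by omega
        simp [hω, hiC, hiF]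
      have := measure_congr (eventuallyEq_univ.2 hae)
      rwa [measure_univ] at this
    rw [h0]
    simp
  | succ k ih =>
    set G := {ω | ∀ m ≤ k, X (m * h) ω ∈ C ∩ F} with hG
    set Z := {ω | ∃ m ≤ k, X (m * h) ω ∉ F} with hZ
    set V := G ∩ {ω | X (k * h + h) ω ∉ F} with hV
    have hGm : MeasurableSet G := hX.iSup_comap_le _ _ (measurableSet_grid X (C ∩ F) h k)
    have hVm : MeasurableSet V := hGm.inter (hX.measurableSet_mem _ Fᶜ)
    have hstep : c * P i G ≤ P i {ω | ∀ m ≤ k + 1, X (m * h) ω ∈ C ∩ F} + P i V := by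
      refine (hX.mul_le_measure_inter i (k * h) h (measurableSet_grid X (C ∩ F) h k)
        (fun ω hω ↦ hω k le_rfl) hc).trans ?_
      refine (measure_mono ?_).trans (measure_union_le _ _)
      rintro ω ⟨hω, hωC⟩
      by_cases hωF : X (k * h + h) ω ∈ F
      · left
        intro m hm
        rcases Nat.le_succ_iff.1 hm with hm | rfl
        · exact hω m hm
        · have : X (k * h + h) ω ∈ C ∩ F := ⟨hωC, hωF⟩
          simpa [add_mul] using this
      · exact Or.inr ⟨hω, hωF⟩
    have hdisj : Disjoint Z V := by
      rw [Set.disjoint_left]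
      rintro ω ⟨m, hm, hmF⟩ ⟨hω, -⟩
      exact hmF (hω m hm).2
    have hexit : P i V + P i Z ≤ P i {ω | ∃ m ≤ k + 1, X (m * h) ω ∉ F} := by
      rw [add_comm, ← measure_union hdisj hVm]
      refine measure_mono ?_
      rintro ω (⟨m, hm, hmF⟩ | ⟨-, hω⟩)
      · exact ⟨m, by omega, hmF⟩
      · exact ⟨k + 1, le_rfl, by simpa [add_mul] using hω⟩
    calc c ^ (k + 1) = c * c ^ k := pow_succ' c k
      _ ≤ c * (P i G + P i Z) := by gcongr
      _ = c * P i G + c * P i Z := mul_add _ _ _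
      _ ≤ (P i {ω | ∀ m ≤ k + 1, X (m * h) ω ∈ C ∩ F} + P i V) + 1 * P i Z := by gcongr
      _ = P i {ω | ∀ m ≤ k + 1, X (m * h) ω ∈ C ∩ F} + (P i V + P i Z) := by
          rw [one_mul, add_assoc]
      _ ≤ _ := by gcongr

end IsContinuousTimeMarkovChain

/-- The bound `ℙ_i(X_h ∈ D) > ch` combines with `1 - x ≤ e^{-x}`. -/
lemma IsQMatrix.eventually_measure_compl_le (hX : IsContinuousTimeMarkovChain X P)
    {q : S → S → ℝ} (hq : IsQMatrix X P q) (hcons : IsConservative q) {D : Set S} {i : S}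
    (hi : i ∉ D) {c : ℝ} (hc : c < killingRate q D i) :
    ∀ᶠ h : ℝ in 𝓝[>] 0,
      P i {ω | X h.toNNReal ω ∈ Dᶜ} ≤ ENNReal.ofReal (Real.exp (-(c * h))) := by
  have := hX.isProbabilityMeasure i
  filter_upwards [hq.eventually_lt_measure_mem hX hcons i D hc] with h hh
  rw [indicator_of_notMem hi, zero_add] at hh
  rw [← ofReal_measureReal]
  refine ENNReal.ofReal_le_ofReal ?_
  have : {ω | X h.toNNReal ω ∈ Dᶜ} = {ω | X h.toNNReal ω ∈ D}ᶜ := rfl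
  rw [this, probReal_compl_eq_one_sub (hX.measurableSet_mem _ D)]
  have := Real.add_one_le_exp (-(c * h))
  linarith

/-- Finite initial segments of an enumeration of `S` eventually contain the almost surely finite
range on `[0, t]`; continuity from above concludes. All grids are treated at once, so `F` can be
fixed before the mesh. -/
lemma exists_finite_measure_exit_lt (hX : IsContinuousTimeMarkovChain X P)
    (hne : IsNonExplosive X P) (i : S) (t : ℝ≥0) {δ : ℝ≥0∞} (hδ : 0 < δ) :
    ∃ F : Set S, F.Finite ∧ i ∈ F ∧
      P i {ω | ∃ n k : ℕ, k ≤ n ∧ X (k * (t / n)) ω ∉ F} < δ := by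
  have := hX.isProbabilityMeasure i
  obtain ⟨e, he⟩ := exists_injective_nat S
  let Z : ℕ → Set Ω := fun N ↦ {ω | ∃ n k : ℕ, k ≤ n ∧ X (k * (t / n)) ω ∉ {s | e s ≤ N}}
  have hZm : ∀ N, MeasurableSet (Z N) := by
    intro N
    simp only [Z, ofPred_exists, ofPred_and]
    exact .iUnion fun n ↦ .iUnion fun k ↦ (MeasurableSet.const _).inter
      (hX.measurableSet_mem _ {s | e s ≤ N}ᶜ)
  have hanti : Antitone Z := by
    rintro N M hNM ω ⟨n, k, hk, h⟩
    exact ⟨n, k, hk, fun h' ↦ h (le_trans h' hNM)⟩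
  have hnull : P i (⋂ N, Z N) = 0 := by
    rw [measure_eq_zero_iff_ae_notMem]
    filter_upwards [hne i, hX.rightContinuous i] with ω hfin hrc hmem
    obtain ⟨N, hN⟩ := ((finite_image_Iic_of_finite_jumpTimes hrc t (hfin t)).image e).bddAbove
    obtain ⟨n, k, hk, h⟩ := mem_iInter.1 hmem N
    refine h (hN (mem_image_of_mem e (mem_image_of_mem (fun u ↦ X u ω) ?_)))
    exact grid_point_le t hk
  have hlim := tendsto_measure_iInter_atTop (μ := P i)
    (fun N ↦ (hZm N).nullMeasurableSet) hanti ⟨0, measure_ne_top _ _⟩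
  rw [hnull] at hlim
  obtain ⟨N, hN, hiN⟩ := ((hlim.eventually_lt_const hδ).and (eventually_ge_atTop (e i))).exists
  exact ⟨{s | e s ≤ N}, (finite_Iic N).preimage he.injOn, hiN, hN⟩

lemma measurableSet_forall_grid_notMem (hX : IsContinuousTimeMarkovChain X P) (D : Set S)
    (t : ℝ≥0) : MeasurableSet {ω | ∀ n k : ℕ, k ≤ n → X (k * (t / n)) ω ∉ D} := by
  simp only [ofPred_forall]
  exact .iInter fun n ↦ .iInter fun k ↦ .iInter fun _ ↦ hX.measurableSet_mem _ Dᶜ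

lemma measure_lt_firstPassageTime_le (hX : IsContinuousTimeMarkovChain X P)
    (hne : IsNonExplosive X P) {q : S → S → ℝ} (hq : IsQMatrix X P q) (hcons : IsConservative q)
    {D : Set S} {t : ℝ≥0} (ht : 0 < t) (i : S) {c : ℝ}
    (hc : ∀ j ∉ D, c < killingRate q D j) :
    P i {ω | (t : WithTop ℝ≥0) < firstPassageTime X D ω}
      ≤ ENNReal.ofReal (Real.exp (-(c * t))) := by
  refine ENNReal.le_of_forall_pos_le_add fun δ hδ _ ↦ ?_
  obtain ⟨F, hF, hiF, hFδ⟩ := exists_finite_measure_exit_lt hX hne i t (δ := δ) (by simpa using hδ)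
  rw [measure_congr (lt_firstPassageTime_ae_eq hX D t i)]
  have hev : ∀ᶠ h : ℝ in 𝓝[>] 0, ∀ j ∈ F ∩ Dᶜ,
      P j {ω | X h.toNNReal ω ∈ Dᶜ} ≤ ENNReal.ofReal (Real.exp (-(c * h))) :=
    (hF.inter_of_left _).eventually_all.2 fun j hj ↦
      hq.eventually_measure_compl_le hX hcons hj.2 (hc j hj.2)
  -- One fine grid is enough here, since `{t < T}` is contained in every grid event.
  obtain ⟨n, hn, hn1⟩ := (((tendsto_div_nat_nhdsGT ht).eventually hev).and
    (eventually_ge_atTop 1)).exists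
  have hcast : ((t : ℝ) / n).toNNReal = t / n := by
    rw [← NNReal.coe_natCast, ← NNReal.coe_div, Real.toNNReal_coe]
  rw [hcast] at hn
  have hpow := hX.measure_grid_le_pow i (t / n) inter_subset_right hn n
  rw [ofReal_exp_pow hn1] at hpow
  refine (measure_mono ?_).trans ((measure_union_le _ _).trans (add_le_add hpow hFδ.le))
  intro ω hω
  by_cases h : ∃ n k : ℕ, k ≤ n ∧ X (k * (t / n)) ω ∉ F
  · exact Or.inr h
  · push Not at h
    exact Or.inl fun m hm ↦ ⟨h n m hm, hω n m hm⟩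

lemma le_measure_lt_firstPassageTime (hX : IsContinuousTimeMarkovChain X P)
    (hne : IsNonExplosive X P) {q : S → S → ℝ} (hq : IsQMatrix X P q) (hcons : IsConservative q)
    {D : Set S} {t : ℝ≥0} (ht : 0 < t) {i : S} (hi : i ∉ D) {c : ℝ}
    (hc : ∀ j ∉ D, killingRate q D j < c) :
    ENNReal.ofReal (Real.exp (-(c * t)))
      ≤ P i {ω | (t : WithTop ℝ≥0) < firstPassageTime X D ω} := by
  have := hX.isProbabilityMeasure i
  refine ENNReal.le_of_forall_pos_le_add fun δ hδ _ ↦ ?_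
  obtain ⟨F, hF, hiF, hFδ⟩ := exists_finite_measure_exit_lt hX hne i t (δ := δ) (by simpa using hδ)
  rw [measure_congr (lt_firstPassageTime_ae_eq hX D t i)]
  have hc0 : 0 ≤ c := (hq.killingRate_nonneg hX hi).trans (hc i hi).le
  have hev : ∀ᶠ h : ℝ in 𝓝[>] 0, ∀ j ∈ F ∩ Dᶜ,
      ENNReal.ofReal (Real.exp (-(c * h))) ≤ P j {ω | X h.toNNReal ω ∈ Dᶜ} :=
    (hF.inter_of_left _).eventually_all.2 fun j hj ↦
      hq.eventually_le_measure_compl hX hcons hj.2 (hc j hj.2)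
  -- Avoidance on one grid does not imply `t < T`, so the lower bound needs `n → ∞`.
  have hlim : Tendsto (fun n : ℕ ↦ P i {ω | ∀ k ≤ n, X (k * (t / n)) ω ∈ Dᶜ}) atTop
      (𝓝 (P i {ω | ∀ n k : ℕ, k ≤ n → X (k * (t / n)) ω ∉ D})) := by
    refine tendsto_measure_of_ae_tendsto_indicator_of_isFiniteMeasure _
      (measurableSet_forall_grid_notMem hX D t)
      (fun n ↦ hX.iSup_comap_le _ _ (measurableSet_grid X Dᶜ (t / n) n)) ?_
    filter_upwards [hX.rightContinuous i] with ω hrc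
    by_cases hω : ∀ n k : ℕ, k ≤ n → X (k * (t / n)) ω ∉ D
    · exact .of_forall fun n ↦ iff_of_true (hω n) hω
    · obtain ⟨n, k, hk, hkD⟩ : ∃ n k : ℕ, k ≤ n ∧ X (k * (t / n)) ω ∈ D := by
        push Not at hω
        exact hω
      filter_upwards [eventually_exists_grid_mem (x := fun u ↦ X u ω) hrc (grid_point_le t hk) hkD]
        with m ⟨l, hl, hlD⟩
      exact iff_of_false (fun h ↦ h l hl hlD) hω
  refine ge_of_tendsto (hlim.add_const (δ : ℝ≥0∞)) ?_
  filter_upwards [(tendsto_div_nat_nhdsGT ht).eventually hev, eventually_ge_atTop 1] with n hn hn1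
  have hcast : ((t : ℝ) / n).toNNReal = t / n := by
    rw [← NNReal.coe_natCast, ← NNReal.coe_div, Real.toNNReal_coe]
  rw [hcast] at hn
  have hc1 : ENNReal.ofReal (Real.exp (-(c * (t / n)))) ≤ 1 := by
    rw [ENNReal.ofReal_le_one, Real.exp_le_one_iff, neg_nonpos]
    positivity
  have hpow := hX.pow_le_measure_grid_add i (t / n) (C := Dᶜ) hi hiF hc1
    (fun j hj ↦ hn j hj.symm) n
  rw [ofReal_exp_pow hn1] at hpow
  refine hpow.trans (add_le_add (measure_mono fun ω hω m hm ↦ (hω m hm).1)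
    (le_trans (measure_mono ?_) hFδ.le))
  rintro ω ⟨m, hm, h⟩
  exact ⟨n, m, hm, h⟩

end Chain

theorem proposition1 {S Ω : Type*} [Countable S] [MeasurableSpace S] [MeasurableSingletonClass S]
    [MeasurableSpace Ω] (X : ℝ≥0 → Ω → S) (P : S → Measure Ω) (q : S → S → ℝ)
    (hX : IsContinuousTimeMarkovChain X P) (hne : IsNonExplosive X P)
    (hq : IsQMatrix X P q) (hcons : IsConservative q) (D : Set S) :
    ∀ (t : ℝ≥0) (i : S), i ∉ D →
      NullMeasurableSet {ω | (t : WithTop ℝ≥0) < firstPassageTime X D ω} (P i) ∧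
      EReal.exp (-(supKillingRate q D * ((t : ℝ) : EReal)))
        ≤ P i {ω | (t : WithTop ℝ≥0) < firstPassageTime X D ω} ∧
      P i {ω | (t : WithTop ℝ≥0) < firstPassageTime X D ω}
        ≤ EReal.exp (-(infKillingRate q D * ((t : ℝ) : EReal))) := by
  intro t i hi
  refine ⟨(measurableSet_forall_grid_notMem hX D t).nullMeasurableSet.congr
    (lt_firstPassageTime_ae_eq hX D t i).symm, ?_⟩
  rcases eq_or_ne t 0 with rfl | ht0
  · rw [measure_zero_lt_firstPassageTime hX hi]
    simp
  have ht : 0 < t := pos_iff_ne_zero.2 ht0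
  constructor
  · have hsup : ∀ j ∉ D, (killingRate q D j : EReal) ≤ supKillingRate q D :=
      fun j hj ↦ le_iSup₂ (f := fun j (_ : j ∈ Dᶜ) ↦ (killingRate q D j : EReal)) j hj
    generalize supKillingRate q D = a at hsup ⊢
    induction a with
    | bot => exact absurd (hsup i hi) (by simp)
    | top =>
      rw [EReal.top_mul_coe_of_pos (by exact_mod_cast ht), EReal.neg_top, EReal.exp_bot]
      exact zero_le
    | coe a =>
      rw [← EReal.coe_mul, ← EReal.coe_neg, EReal.exp_coe]
      -- The strict inequalities used for the one-step bounds hold for every `c > a`; continuity in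
      -- `c` recovers `a`.
      refine le_of_tendsto ((tendsto_ofReal_exp_neg_mul a t).mono_left nhdsWithin_le_nhds :
        Tendsto _ (𝓝[>] a) _) ?_
      filter_upwards [self_mem_nhdsWithin] with c hc
      exact le_measure_lt_firstPassageTime hX hne hq hcons ht hi fun j hj ↦
        (EReal.coe_le_coe_iff.1 (hsup j hj)).trans_lt hc
  · have hinf : ∀ j ∉ D, infKillingRate q D ≤ (killingRate q D j : EReal) :=
      fun j hj ↦ iInf₂_le (f := fun j (_ : j ∈ Dᶜ) ↦ (killingRate q D j : EReal)) j hj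
    have hinf0 : 0 ≤ infKillingRate q D :=
      le_iInf₂ fun j hj ↦ EReal.coe_nonneg.2 (hq.killingRate_nonneg hX hj)
    generalize infKillingRate q D = a at hinf hinf0 ⊢
    induction a with
    | bot => exact absurd hinf0 (by simp)
    | top => exact absurd (hinf i hi) (by simp)
    | coe a =>
      rw [← EReal.coe_mul, ← EReal.coe_neg, EReal.exp_coe]
      refine ge_of_tendsto ((tendsto_ofReal_exp_neg_mul a t).mono_left nhdsWithin_le_nhds :
        Tendsto _ (𝓝[<] a) _) ?_
      filter_upwards [self_mem_nhdsWithin] with c hc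
      exact measure_lt_firstPassageTime_le hX hne hq hcons ht i fun j hj ↦
        lt_of_lt_of_le hc (EReal.coe_le_coe_iff.1 (hinf j hj))
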